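/- Let $F$ be an arbitrary field; algebras are associative, not necessarily commutative or unital. For a non-principal ultrafilter $\mathcal U$ on $\mathbb N$ and a sequence $(n_k)_k$ of natural numbers tending to infinity, put $\rho_{\mathcal U}\big((A_k)_k\big)=\lim_{k\to\mathcal U}\frac{1}{n_k}\operatorname{rank}(A_k)$ for $(A_k)_k\in\prod_k M_{n_k}(F)$. A countably generated $F$-algebra $A$ is called linear sofic if, for some such $\mathcal U$ and $(n_k)_k$, there is an injective homomorphism of $F$-algebras (not required to preserve a unit) $A\to\prod_k M_{n_k}(F)/\operatorname{Ker}(\rho_{\mathcal U})$. A ring is Jacobson radical if all of its elements are quasi-invertible. The unital hull of an $F$-algebra $A$ is $A^1=F\oplus A$ with multiplication $(\alpha+a)(\alpha'+a')=\alpha\alpha'+\alpha a'+\alpha' a+aa'$. A unital ring $B$ is stably finite if, for every $n\in\mathbb N$ and all $X,Y\in M_n(B)$, $XY=1$ implies $YX=1$. Theorem. Over every field $F$ there exists a finitely generated $F$-algebra $A$ which is Jacobson radical and not linear sofic, and whose unital hull $A^1$ is stably finite and not linear sofic. -/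

import Mathlib

open Filter Topology

universe u

/-- The product of the matrix algebras `M_{n_k}(F)`, `k ∈ ℕ`. -/
abbrev MatrixProduct (F : Type*) [Field F] (n : ℕ → ℕ) : Type _ :=
  ∀ k : ℕ, Matrix (Fin (n k)) (Fin (n k)) F

/-- The asymptotic rank function `ρ_U((A_k)_k) = lim_{k → U} rank(A_k) / n_k`.
The limit exists, see `tendsto_asymptoticRank`. -/
noncomputable def asymptoticRank {F : Type*} [Field F] (U : Ultrafilter ℕ) (n : ℕ → ℕ)
    (A : MatrixProduct F n) : ℝ :=
  limUnder (U : Filter ℕ) fun k => ((A k).rank : ℝ) / (n k : ℝ)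

theorem tendsto_asymptoticRank {F : Type*} [Field F] (U : Ultrafilter ℕ) (n : ℕ → ℕ)
    (A : MatrixProduct F n) :
    Tendsto (fun k => ((A k).rank : ℝ) / (n k : ℝ)) (U : Filter ℕ) (𝓝 (asymptoticRank U n A)) := by
  have h : ∀ k, ((A k).rank : ℝ) / (n k : ℝ) ∈ Set.Icc (0 : ℝ) 1 := fun k =>
    ⟨by positivity, div_le_one_of_le₀ (by exact_mod_cast (A k).rank_le_height) (by positivity)⟩
  obtain ⟨x, -, hx⟩ := (isCompact_Icc : IsCompact (Set.Icc (0 : ℝ) 1)).ultrafilter_le_nhds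
    (U.map fun k => ((A k).rank : ℝ) / (n k : ℝ))
    (by
      rw [le_principal_iff]
      exact Filter.mem_map.2 (Filter.univ_mem' h))
  exact tendsto_nhds_limUnder ⟨x, hx⟩

theorem asymptoticRank_eq_zero_of_le {F : Type*} [Field F] {U : Ultrafilter ℕ} {n : ℕ → ℕ}
    {A B C : MatrixProduct F n} (hB : asymptoticRank U n B = 0) (hC : asymptoticRank U n C = 0)
    (h : ∀ k, (A k).rank ≤ (B k).rank + (C k).rank) : asymptoticRank U n A = 0 := by
  have hB' := tendsto_asymptoticRank U n B
  have hC' := tendsto_asymptoticRank U n C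
  rw [hB] at hB'
  rw [hC] at hC'
  have hs := hB'.add hC'
  rw [add_zero] at hs
  refine tendsto_nhds_unique (tendsto_asymptoticRank U n A)
    (squeeze_zero (fun k => by positivity) (fun k => ?_) hs)
  rw [← add_div]
  gcongr
  exact_mod_cast h k

theorem Matrix.rank_add_le_rank_add_rank {F : Type*} [Field F] {m : ℕ}
    (A B : Matrix (Fin m) (Fin m) F) : (A + B).rank ≤ A.rank + B.rank := by
  unfold Matrix.rank
  rw [Matrix.mulVecLin_add]
  exact (Submodule.finrank_mono (LinearMap.range_add_le _ _)).trans
    (Submodule.finrank_add_le_finrank_add_finrank _ _)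

theorem asymptoticRank_zero {F : Type*} [Field F] (U : Ultrafilter ℕ) (n : ℕ → ℕ) :
    asymptoticRank U n (0 : MatrixProduct F n) = 0 := by
  refine tendsto_nhds_unique (tendsto_asymptoticRank U n 0) ?_
  simp

/-- The kernel of the asymptotic rank function. -/
def rankKernel (F : Type*) [Field F] (U : Ultrafilter ℕ) (n : ℕ → ℕ) :
    Ideal (MatrixProduct F n) where
  carrier := {A | asymptoticRank U n A = 0}
  zero_mem' := asymptoticRank_zero U n
  add_mem' {A B} hA hB :=
    asymptoticRank_eq_zero_of_le hA hB fun k => Matrix.rank_add_le_rank_add_rank (A k) (B k)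
  smul_mem' C A hA :=
    asymptoticRank_eq_zero_of_le hA (asymptoticRank_zero U n) fun k =>
      (Matrix.rank_mul_le_right (C k) (A k)).trans (Nat.le_add_right _ _)

instance rankKernel_isTwoSided (F : Type*) [Field F] (U : Ultrafilter ℕ) (n : ℕ → ℕ) :
    (rankKernel F U n).IsTwoSided where
  mul_mem_of_left {A} C hA :=
    asymptoticRank_eq_zero_of_le (A := A * C) hA (asymptoticRank_zero U n) fun k =>
      (Matrix.rank_mul_le_left (A k) (C k)).trans (Nat.le_add_right _ _)

/-- The metric ultraproduct `∏_{k → U} M_{n_k}(F) / Ker(ρ_U)`. -/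
abbrev MetricUltraproduct (F : Type*) [Field F] (U : Ultrafilter ℕ) (n : ℕ → ℕ) : Type _ :=
  MatrixProduct F n ⧸ rankKernel F U n

/-- An associative, not necessarily unital, `F`-algebra `A` is linear sofic if, for some
non-principal ultrafilter `U` on `ℕ` and some sequence `n_k → ∞`, there is an injective
homomorphism of `F`-algebras (not required to preserve a unit) from `A` to the metric ultraproduct
of the `M_{n_k}(F)`. The notion is meant for countably generated algebras. -/
def IsLinearSofic (F : Type*) [Field F] (A : Type*) [NonUnitalRing A] [Module F A] : Prop :=
  ∃ (U : Ultrafilter ℕ) (n : ℕ → ℕ), (∀ k : ℕ, U ≠ pure k) ∧ Tendsto n atTop atTop ∧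
    ∃ Φ : A →ₙₐ[F] MetricUltraproduct F U n, Function.Injective Φ

/-- A (not necessarily unital) ring is Jacobson radical if it equals its own Jacobson radical,
i.e. if each of its elements is quasi-invertible. -/
def IsJacobsonRadicalRing (A : Type*) [NonUnitalRing A] : Prop :=
  ∀ a : A, IsQuasiregular a

/-- A (not necessarily unital) algebra is finitely generated if it is generated by a finite subset
as a non-unital algebra. -/
def IsFinitelyGeneratedAlgebra (F : Type*) [Field F] (A : Type*) [NonUnitalRing A] [Module F A]
    [IsScalarTower F A A] [SMulCommClass F A A] : Prop :=
  ∃ s : Finset A, NonUnitalAlgebra.adjoin F (s : Set A) = ⊤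

/-!
The algebra is built from an infinite *dual family*: elements `p i`, `q j` (`i, j ∈ ℕ`) and
`z ≠ 0` with `p i * q j = δ_ij z`. Such a family cannot live in a metric ultraproduct of matrix
algebras. Indeed, for `N × N` matrices the block matrix `(P i * Q j)` with `i, j < m` factors
through `F ^ N`, so its rank is at most `N`; if it is close in rank to the block diagonal matrix
with `m` blocks `Z`, then `m * rank Z` is at most about `N` (`card_mul_rank_le`), so the normalized
rank of `z` is at most `1 / m` for all `m` (`not_isLinearSofic_of_dual_families`).

To find a dual family in a finitely generated radical algebra, start from a finitely generated
infinite-dimensional nil algebra, as in the Golod–Shafarevich solution of the Kurosh problem. For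
each `k`, all linear combinations of nonempty words of length at most `k` in three letters are made
nilpotent of a large exponent `N`, by imposing the coefficients of the `N`-th power of the generic
such combination as relations. Their number is polynomial in `N` and their degrees are at least
`N`, so for large `N` they are sparse enough for the Golod–Shafarevich recursion to leave a nonzero
word in every degree (`exists_monomialWord_notMem_relationPart`). This works over every field,
because the relations do not depend on the coefficients of the combination.

Let `M` be the quotient of the free algebra by these relations, let `φ` be a functional on `M` that
is supported in the degrees `2 ^ (k + 1)` and takes the value `1` on one word in each of these
degrees, and cut these words into halves `g k`, `h k`. Since `2 ^ i + 2 ^ j` is a power of `2` only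
for `i = j`, we get `φ (g i * h j) = δ_ij` (`exists_functional_wordAlgebra`). With the
rank one operator `c = φ(·) 1` on `M`, the `3 × 3` matrices over `End M` generated by the `E₁₁ xᵢ`,
by `E₀₁ c` and by `E₁₂ c` contain the dual family `E₀₁ c (g i)`, `E₁₂ (h j) c`, `E₀₂ c`. These
matrices are upper triangular with diagonal `(0, nil, 0)`, hence nilpotent, hence quasi-invertible.

Stable finiteness of the unital hull is a property of all radical algebras
(`isStablyFiniteRing_unitization`).
-/

/-! ### The Golod–Shafarevich recursion -/

/-- The free algebra `F⟨x₀, x₁, x₂⟩`, as the algebra of the free monoid of words. -/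
abbrev WordAlgebra (F : Type u) [Field F] : Type u := MonoidAlgebra F (FreeMonoid (Fin 3))

/-- A word, as an element of the free algebra. -/
noncomputable abbrev monomialWord (F : Type u) [Field F] : FreeMonoid (Fin 3) →* WordAlgebra F :=
  MonoidAlgebra.of F (FreeMonoid (Fin 3))

/-- The homogeneous component of degree `n` of the free algebra. -/
noncomputable def homogeneousPart (F : Type u) [Field F] (n : ℕ) : Submodule F (WordAlgebra F) :=
  Submodule.span F (monomialWord F '' {w | w.length = n})

section GolodShafarevich

variable {F : Type u} [Field F] {ι : Type*}

theorem linearIndependent_monomialWord : LinearIndependent F (monomialWord F) := by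
  have h := (MonoidAlgebra.basis (FreeMonoid (Fin 3)) F).linearIndependent
  convert h using 1
  ext1 w
  rw [MonoidAlgebra.basis_apply]; rfl

theorem span_range_monomialWord : Submodule.span F (Set.range (monomialWord F)) = ⊤ := by
  have h := (MonoidAlgebra.basis (FreeMonoid (Fin 3)) F).span_eq
  convert h using 3
  ext1 w
  rw [MonoidAlgebra.basis_apply]; rfl

theorem homogeneousPart_eq_span_vector (n : ℕ) :
    homogeneousPart F n =
      Submodule.span F (Set.range fun v : List.Vector (Fin 3) n => monomialWord F v.1) := by
  unfold homogeneousPart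
  congr 1
  ext x
  constructor
  · rintro ⟨w, hw, rfl⟩
    exact ⟨⟨w, hw⟩, rfl⟩
  · rintro ⟨v, rfl⟩
    exact ⟨v.1, v.2, rfl⟩

instance finiteDimensional_homogeneousPart (n : ℕ) :
    FiniteDimensional F (homogeneousPart F n) := by
  rw [homogeneousPart_eq_span_vector]
  exact FiniteDimensional.span_of_finite F (Set.finite_range _)

theorem finrank_homogeneousPart (n : ℕ) : Module.finrank F (homogeneousPart F n) = 3 ^ n := by
  rw [homogeneousPart_eq_span_vector, finrank_span_eq_card, card_vector, Fintype.card_fin]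
  exact linearIndependent_monomialWord.comp (fun v : List.Vector (Fin 3) n => v.1)
    Subtype.val_injective

theorem monomialWord_mem_homogeneousPart (w : FreeMonoid (Fin 3)) :
    monomialWord F w ∈ homogeneousPart F w.length :=
  Submodule.subset_span ⟨w, rfl, rfl⟩

theorem mul_mem_homogeneousPart {m n : ℕ} {a b : WordAlgebra F} (ha : a ∈ homogeneousPart F m)
    (hb : b ∈ homogeneousPart F n) : a * b ∈ homogeneousPart F (m + n) := by
  have h := Submodule.mul_mem_mul ha hb
  unfold homogeneousPart at h ⊢
  rw [Submodule.span_mul_span] at h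
  refine Submodule.span_mono ?_ h
  rintro _ ⟨_, ⟨u, hu, rfl⟩, _, ⟨v, hv, rfl⟩, rfl⟩
  exact ⟨u * v, by simp_all, by simp⟩

/-- The degree `n` component of the two-sided ideal generated by the homogeneous elements `r i` of
degrees `deg i`, spanned by the products `u * r i * v` of degree `n` with words `u` and `v`. -/
noncomputable def relationPart (r : ι → WordAlgebra F) (deg : ι → ℕ) (n : ℕ) : Submodule F (WordAlgebra F) :=
  Submodule.span F {x | ∃ u i v, u.length + deg i + v.length = n ∧
    x = monomialWord F u * r i * monomialWord F v}

variable {r : ι → WordAlgebra F} {deg : ι → ℕ}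

theorem relationPart_le (hr : ∀ i, r i ∈ homogeneousPart F (deg i)) (n : ℕ) :
    relationPart r deg n ≤ homogeneousPart F n := by
  refine Submodule.span_le.2 ?_
  rintro _ ⟨u, i, v, rfl, rfl⟩
  exact mul_mem_homogeneousPart (mul_mem_homogeneousPart (monomialWord_mem_homogeneousPart u)
    (hr i)) (monomialWord_mem_homogeneousPart v)

theorem mul_monomialWord_mem_relationPart {m : ℕ} {a : WordAlgebra F}
    (ha : a ∈ relationPart r deg m) (w : FreeMonoid (Fin 3)) :
    a * monomialWord F w ∈ relationPart r deg (m + w.length) := by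
  have h : relationPart r deg m ≤
      (relationPart r deg (m + w.length)).comap (LinearMap.mulRight F (monomialWord F w)) := by
    refine Submodule.span_le.2 ?_
    rintro _ ⟨u, i, v, rfl, rfl⟩
    rw [SetLike.mem_coe, Submodule.mem_comap, LinearMap.mulRight_apply]
    refine Submodule.subset_span ⟨u, i, v * w, ?_, ?_⟩
    · rw [FreeMonoid.length_mul]; ring
    · rw [map_mul, mul_assoc, mul_assoc]
  have := h ha
  rwa [Submodule.mem_comap, LinearMap.mulRight_apply] at this

/-- A nonempty word splits off its last letter. -/
theorem FreeMonoid.exists_mul_of_of_length {w : FreeMonoid (Fin 3)} {n : ℕ}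
    (h : w.length = n + 1) : ∃ v x, v.length = n ∧ w = v * FreeMonoid.of x := by
  have hne : w.toList ≠ [] := by
    intro h0
    have : w.length = 0 := by
      change w.toList.length = 0
      rw [h0]; rfl
    omega
  refine ⟨FreeMonoid.ofList w.toList.dropLast, w.toList.getLast hne, ?_, ?_⟩
  · change w.toList.dropLast.length = n
    rw [List.length_dropLast]
    change w.length - 1 = n
    omega
  · apply FreeMonoid.toList.injective
    rw [FreeMonoid.toList_mul]
    exact (List.dropLast_append_getLast hne).symm

/-- Splitting off the last letter of `t`: an ideal element times a form of positive degree is a sum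
of ideal elements times letters, so it brings no new elements into degree `n + 1`. -/
theorem mul_mem_iSup_mulRight {m j n : ℕ} (hmj : m + (j + 1) = n + 1) {a t : WordAlgebra F}
    (ha : a ∈ relationPart r deg m) (ht : t ∈ homogeneousPart F (j + 1)) :
    a * t ∈ ⨆ x : Fin 3, (relationPart r deg n).map
      (LinearMap.mulRight F (monomialWord F (FreeMonoid.of x))) := by
  have h : homogeneousPart F (j + 1) ≤ (⨆ x : Fin 3, (relationPart r deg n).map
      (LinearMap.mulRight F (monomialWord F (FreeMonoid.of x)))).comap (LinearMap.mulLeft F a) := by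
    refine Submodule.span_le.2 ?_
    rintro _ ⟨w, hw, rfl⟩
    obtain ⟨v, x, hv, rfl⟩ := FreeMonoid.exists_mul_of_of_length hw
    rw [SetLike.mem_coe, Submodule.mem_comap, LinearMap.mulLeft_apply]
    refine Submodule.mem_iSup_of_mem x ⟨a * monomialWord F v, ?_, ?_⟩
    · have := mul_monomialWord_mem_relationPart ha v
      rwa [hv, show m + j = n by omega] at this
    · rw [LinearMap.mulRight_apply, map_mul, mul_assoc]
  have := h ht
  rwa [Submodule.mem_comap, LinearMap.mulLeft_apply] at this

theorem exists_isCompl_relationPart (hr : ∀ i, r i ∈ homogeneousPart F (deg i)) (n : ℕ) :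
    ∃ B : Submodule F (WordAlgebra F), relationPart r deg n ⊔ B = homogeneousPart F n ∧
      Module.finrank F (relationPart r deg n) + Module.finrank F B = 3 ^ n := by
  obtain ⟨C, hC⟩ := Submodule.exists_isCompl (relationPart r deg n)
  have hle := relationPart_le hr n
  refine ⟨C ⊓ homogeneousPart F n, ?_, ?_⟩
  · rw [← sup_inf_assoc_of_le _ hle, hC.sup_eq_top, top_inf_eq]
  · have : FiniteDimensional F (relationPart r deg n) := Submodule.finiteDimensional_of_le hle
    have : FiniteDimensional F (C ⊓ homogeneousPart F n : Submodule F (WordAlgebra F)) :=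
      Submodule.finiteDimensional_of_le inf_le_right
    have h := Submodule.finrank_sup_add_finrank_inf_eq (relationPart r deg n)
      (C ⊓ homogeneousPart F n)
    rw [← inf_assoc, hC.inf_eq_bot, bot_inf_eq, finrank_bot, add_zero,
      ← sup_inf_assoc_of_le _ hle, hC.sup_eq_top, top_inf_eq, finrank_homogeneousPart] at h
    exact h.symm

theorem Submodule.finrank_finset_sup_le {V κ : Type*} [AddCommGroup V] [Module F V]
    (s : Finset κ) (f : κ → Submodule F V) (hf : ∀ i ∈ s, FiniteDimensional F (f i)) :
    FiniteDimensional F (s.sup f : Submodule F V) ∧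
      Module.finrank F (s.sup f : Submodule F V) ≤ ∑ i ∈ s, Module.finrank F (f i) := by
  classical
  induction s using Finset.induction_on with
  | empty =>
    rw [Finset.sup_empty]
    exact ⟨inferInstance, by simp⟩
  | insert a s ha ih =>
    obtain ⟨h1, h2⟩ := ih fun i hi => hf i (Finset.mem_insert_of_mem hi)
    have h3 := hf a (Finset.mem_insert_self a s)
    rw [Finset.sup_insert, Finset.sum_insert ha]
    exact ⟨inferInstance, (Submodule.finrank_add_le_finrank_add_finrank _ _).trans (by gcongr)⟩

/-- The Golod–Shafarevich recursion: in degree `n + 1`, the ideal is spanned by its part of degree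
`n` times the letters, and by the products `b * r i` with `b` in a complement of the ideal. -/
theorem finrank_relationPart_succ_le (hr : ∀ i, r i ∈ homogeneousPart F (deg i))
    (hpos : ∀ i, 0 < deg i) {n : ℕ} {s : Finset ι} (hs : ∀ i, i ∈ s ↔ deg i ≤ n + 1) :
    Module.finrank F (relationPart r deg (n + 1)) ≤
      3 * Module.finrank F (relationPart r deg n) +
        ∑ i ∈ s, (3 ^ (n + 1 - deg i) -
          Module.finrank F (relationPart r deg (n + 1 - deg i))) := by
  choose B hB hB' using exists_isCompl_relationPart hr (r := r)
  have hfin : ∀ m, FiniteDimensional F (relationPart r deg m) := fun m =>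
    Submodule.finiteDimensional_of_le (relationPart_le hr m)
  have hBfin : ∀ m, FiniteDimensional F (B m) := fun m =>
    Submodule.finiteDimensional_of_le (le_sup_right.trans (hB m).le)
  set P := fun x : Fin 3 => (relationPart r deg n).map
      (LinearMap.mulRight F (monomialWord F (FreeMonoid.of x))) with hP
  set Q := fun i : ι => (B (n + 1 - deg i)).map (LinearMap.mulRight F (r i)) with hQ
  have hle : relationPart r deg (n + 1) ≤ Finset.univ.sup P ⊔ s.sup Q := by
    refine Submodule.span_le.2 ?_
    rintro _ ⟨u, i, v, hn, rfl⟩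
    have hi := hpos i
    rcases hv : v.length with _ | m
    · rw [FreeMonoid.length_eq_zero] at hv
      subst hv
      rw [FreeMonoid.length_one, add_zero] at hn
      have hu := monomialWord_mem_homogeneousPart (F := F) u
      rw [show u.length = n + 1 - deg i by omega, ← hB, Submodule.mem_sup] at hu
      obtain ⟨a, ha, b, hb, hab⟩ := hu
      rw [map_one, mul_one, ← hab, add_mul]
      refine Submodule.add_mem_sup ?_ ?_
      · rw [Finset.sup_univ_eq_iSup]
        obtain ⟨j, hj⟩ := Nat.exists_eq_add_of_lt hi
        refine mul_mem_iSup_mulRight (j := j) (by omega) ha ?_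
        have := hr i
        rwa [show deg i = j + 1 by omega] at this
      · exact (Finset.le_sup (f := Q) ((hs i).2 (by omega))) ⟨b, hb, rfl⟩
    · refine Submodule.mem_sup_left ?_
      obtain ⟨v', x, hv', rfl⟩ := FreeMonoid.exists_mul_of_of_length hv
      refine (Finset.le_sup (f := P) (Finset.mem_univ x))
        ⟨monomialWord F u * r i * monomialWord F v', ?_, ?_⟩
      · exact Submodule.subset_span ⟨u, i, v', by omega, rfl⟩
      · simp [mul_assoc]
  obtain ⟨hP1, hP2⟩ := Submodule.finrank_finset_sup_le Finset.univ P fun i _ => inferInstance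
  obtain ⟨hQ1, hQ2⟩ := Submodule.finrank_finset_sup_le s Q fun i _ => inferInstance
  refine (Submodule.finrank_mono hle).trans
    ((Submodule.finrank_add_le_finrank_add_finrank _ _).trans (add_le_add (hP2.trans ?_)
      (hQ2.trans ?_)))
  · refine (Finset.sum_le_sum fun x _ => Submodule.finrank_map_le _ _).trans ?_
    simp
  · refine Finset.sum_le_sum fun i _ => (Submodule.finrank_map_le _ _).trans ?_
    have := hB' (n + 1 - deg i)
    omega

/-- If `∑ 2 ^ (-deg i) ≤ 1 / 2`, then the codimension of the ideal at least doubles from each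
degree to the next one. -/
theorem two_mul_codim_relationPart_le (hr : ∀ i, r i ∈ homogeneousPart F (deg i))
    (hpos : ∀ i, 0 < deg i) (hfin : ∀ n, {i | deg i ≤ n}.Finite)
    (hsum : ∀ s : Finset ι, ∑ i ∈ s, ((1 : ℚ) / 2) ^ deg i ≤ 1 / 2) (n : ℕ) :
    2 * ((3 : ℚ) ^ n - Module.finrank F (relationPart r deg n)) ≤
      3 ^ (n + 1) - Module.finrank F (relationPart r deg (n + 1)) := by
  set b : ℕ → ℚ := fun n => (3 : ℚ) ^ n - Module.finrank F (relationPart r deg n) with hb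
  have hrank : ∀ m, Module.finrank F (relationPart r deg m) ≤ 3 ^ m := fun m => by
    rw [← finrank_homogeneousPart (F := F)]
    exact Submodule.finrank_mono (relationPart_le hr m)
  have hb0 : ∀ m, 0 ≤ b m := fun m => by
    have := hrank m
    simp only [hb, sub_nonneg]
    exact_mod_cast this
  change 2 * b n ≤ b (n + 1)
  induction n using Nat.strong_induction_on with
  | _ n ih =>
    have hmono : ∀ k m, m + k = n → b m ≤ (1 / 2) ^ k * b n := by
      intro k
      induction k with
      | zero => rintro m rfl; simp
      | succ k ihk =>
        intro m hm
        have h1 := ih m (by omega)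
        have h2 := ihk (m + 1) (by omega)
        rw [pow_succ]
        linarith
    set s := (hfin (n + 1)).toFinset with hs
    have hs' : ∀ i, i ∈ s ↔ deg i ≤ n + 1 := fun i => by simp [hs]
    have h : (Module.finrank F (relationPart r deg (n + 1)) : ℚ) ≤
        3 * Module.finrank F (relationPart r deg n) + ∑ i ∈ s, b (n + 1 - deg i) := by
      have := finrank_relationPart_succ_le hr hpos hs'
      have h' : (Module.finrank F (relationPart r deg (n + 1)) : ℚ) ≤
        ((3 * Module.finrank F (relationPart r deg n) +
        ∑ i ∈ s, (3 ^ (n + 1 - deg i) -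
          Module.finrank F (relationPart r deg (n + 1 - deg i))) : ℕ) : ℚ) := by
        exact_mod_cast this
      refine h'.trans (le_of_eq ?_)
      push_cast [Nat.cast_sub (hrank _)]
      rfl
    have hsum' : ∑ i ∈ s, b (n + 1 - deg i) ≤ b n := by
      calc ∑ i ∈ s, b (n + 1 - deg i) ≤ ∑ i ∈ s, (1 / 2) ^ deg i * (2 * b n) := by
            refine Finset.sum_le_sum fun i hi => ?_
            have hi' := (hs' i).1 hi
            have hp := hpos i
            refine (hmono (deg i - 1) _ (by omega)).trans (le_of_eq ?_)
            obtain ⟨j, hj⟩ := Nat.exists_eq_add_of_lt hp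
            rw [show deg i = j + 1 by omega, Nat.add_sub_cancel, pow_succ]
            ring
        _ = (∑ i ∈ s, (1 / 2) ^ deg i) * (2 * b n) := by rw [Finset.sum_mul]
        _ ≤ 1 / 2 * (2 * b n) := by
            have := hb0 n
            gcongr
            exact hsum s
        _ = b n := by ring
    have e1 : b (n + 1) = 3 ^ (n + 1) - Module.finrank F (relationPart r deg (n + 1)) := rfl
    have e2 : b n = 3 ^ n - Module.finrank F (relationPart r deg n) := rfl
    rw [pow_succ] at e1
    linarith

/-- **Golod–Shafarevich**: if `∑ 2 ^ (-deg i) ≤ 1 / 2`, then in every degree there is a word outside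
the ideal. -/
theorem exists_monomialWord_notMem_relationPart (hr : ∀ i, r i ∈ homogeneousPart F (deg i))
    (hpos : ∀ i, 0 < deg i) (hfin : ∀ n, {i | deg i ≤ n}.Finite)
    (hsum : ∀ s : Finset ι, ∑ i ∈ s, ((1 : ℚ) / 2) ^ deg i ≤ 1 / 2) (n : ℕ) :
    ∃ w : FreeMonoid (Fin 3), w.length = n ∧ monomialWord F w ∉ relationPart r deg n := by
  have h : ∀ n, (0 : ℚ) < (3 : ℚ) ^ n - Module.finrank F (relationPart r deg n) := by
    intro n
    induction n with
    | zero =>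
      have : relationPart r deg 0 = ⊥ := by
        refine Submodule.span_eq_bot.2 ?_
        rintro _ ⟨u, i, v, h, -⟩
        have := hpos i
        omega
      rw [this]
      simp
    | succ n ih =>
      have := two_mul_codim_relationPart_le hr hpos hfin hsum n
      linarith
  by_contra! hcon
  have hle : homogeneousPart F n ≤ relationPart r deg n := by
    refine Submodule.span_le.2 ?_
    rintro _ ⟨w, hw, rfl⟩
    exact hcon w hw
  have heq := le_antisymm (relationPart_le hr n) hle
  have := h n
  rw [heq, finrank_homogeneousPart] at this
  simp at this

end GolodShafarevich

/-! ### Relations for a nil algebra -/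

section PowerRelations

/-- The valueMultiplicity functions of the multisets of `N` elements of `J`. -/
abbrev Multiplicity (J : Type*) [Fintype J] (N : ℕ) : Type _ :=
  {c : J → Fin (N + 1) // ∑ j, (c j : ℕ) = N}

/-- The multiplicities with which a sequence of length `N` takes its values. -/
def valueMultiplicity {J : Type*} [Fintype J] [DecidableEq J] {N : ℕ} (f : Fin N → J) :
    Multiplicity J N :=
  ⟨fun j => ⟨Finset.card {i | f i = j}, Nat.lt_succ_of_le
      ((Finset.card_le_univ _).trans (Fintype.card_fin N).le)⟩, by
    have h := Finset.card_eq_sum_card_fiberwise (f := f) (s := Finset.univ) (t := Finset.univ)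
      fun _ _ => Finset.mem_coe.2 (Finset.mem_univ _)
    rw [Finset.card_univ, Fintype.card_fin] at h
    exact h.symm⟩

/-- The coefficient of the monomial with exponents `c` in the `N`-th power of the generic linear
combination of the `w j`: the sum of the products of all rearrangements of the multiset `c`. -/
def powerCoefficient {T J : Type*} [Semiring T] [Fintype J] [DecidableEq J] {N : ℕ} (w : J → T)
    (c : Multiplicity J N) : T :=
  ∑ f : Fin N → J with valueMultiplicity f = c, (List.ofFn fun i => w (f i)).prod

theorem sum_smul_pow {F T J : Type*} [Field F] [Ring T] [Algebra F T] [Fintype J]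
    (w : J → T) (α : J → F) (N : ℕ) :
    (∑ j, α j • w j) ^ N =
      ∑ f : Fin N → J, (∏ i, α (f i)) • (List.ofFn fun i => w (f i)).prod := by
  induction N with
  | zero => simp
  | succ N ih =>
    rw [pow_succ', ih, ← (Fin.consEquiv fun _ => J).sum_comp, Fintype.sum_prod_type,
      Finset.sum_mul_sum]
    refine Finset.sum_congr rfl fun j _ => Finset.sum_congr rfl fun f _ => ?_
    simp [Fin.consEquiv, Fin.prod_univ_succ, List.ofFn_succ, smul_smul, mul_comm]

theorem sum_comp_eq_multiplicity {J : Type*} [Fintype J] [DecidableEq J] {N : ℕ} (f : Fin N → J)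
    (g : J → ℕ) : ∑ i, g (f i) = ∑ j, ((valueMultiplicity f).1 j : ℕ) * g j := by
  rw [← Finset.sum_fiberwise (s := Finset.univ) (g := f)]
  refine Finset.sum_congr rfl fun j _ => ?_
  rw [Finset.sum_congr rfl (g := fun _ => g j) fun i hi => by rw [(Finset.mem_filter.1 hi).2],
    Finset.sum_const]
  rfl

theorem prod_comp_eq_multiplicity {F J : Type*} [CommMonoid F] [Fintype J] [DecidableEq J] {N : ℕ}
    (f : Fin N → J) (g : J → F) : ∏ i, g (f i) = ∏ j, g j ^ ((valueMultiplicity f).1 j : ℕ) := by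
  rw [← Finset.prod_fiberwise (s := Finset.univ) (g := f)]
  refine Finset.prod_congr rfl fun j _ => ?_
  rw [Finset.prod_congr rfl (g := fun _ => g j) fun i hi => by rw [(Finset.mem_filter.1 hi).2],
    Finset.prod_const]
  rfl

/-- All `N`-th powers of linear combinations of the `w j` lie in the span of finitely many elements,
whatever the coefficients. -/
theorem sum_smul_pow_mem_span {F T J : Type*} [Field F] [Ring T] [Algebra F T] [Fintype J]
    [DecidableEq J] (w : J → T) (α : J → F) (N : ℕ) :
    (∑ j, α j • w j) ^ N ∈
      Submodule.span F (Set.range fun c : Multiplicity J N => powerCoefficient w c) := by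
  rw [sum_smul_pow, ← Finset.sum_fiberwise (s := Finset.univ) (g := fun f => valueMultiplicity f)]
  refine Submodule.sum_mem _ fun c _ => ?_
  have h : ∑ f : Fin N → J with valueMultiplicity f = c,
      (∏ i, α (f i)) • (List.ofFn fun i => w (f i)).prod =
      (∏ j, α j ^ (c.1 j : ℕ)) • powerCoefficient w c := by
    rw [powerCoefficient, Finset.smul_sum]
    refine Finset.sum_congr rfl fun f hf => ?_
    rw [prod_comp_eq_multiplicity, (Finset.mem_filter.1 hf).2]
  rw [h]
  exact Submodule.smul_mem _ _ (Submodule.subset_span ⟨c, rfl⟩)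

theorem card_multiplicity_le (J : Type*) [Fintype J] [DecidableEq J] (N : ℕ) :
    Fintype.card (Multiplicity J N) ≤ (N + 1) ^ Fintype.card J := by
  refine (Fintype.card_subtype_le _).trans ?_
  rw [Fintype.card_fun, Fintype.card_fin]

/-- Exponentials beat powers. -/
theorem exists_succ_pow_mul_le_two_pow (D C k : ℕ) :
    ∃ N, 0 < N ∧ k ≤ N ∧ (N + 1) ^ D * C ≤ 2 ^ N := by
  have h := tendsto_pow_const_div_const_pow_of_one_lt D (r := 2) one_lt_two
  have h' := (h.comp (tendsto_add_atTop_nat 1)).const_mul (2 * C : ℝ)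
  rw [mul_zero] at h'
  obtain ⟨N, h1, h2⟩ := ((h'.eventually_le_const one_pos).and
    (eventually_ge_atTop (k + 1))).exists
  refine ⟨N, by omega, by omega, ?_⟩
  rw [Function.comp_apply, ← mul_div_assoc, div_le_one (by positivity), pow_succ] at h1
  have h3 : ((N : ℝ) + 1) ^ D * C ≤ 2 ^ N := by
    push_cast at h1
    linarith
  exact_mod_cast h3

/-- The nonempty words of length at most `k`. -/
abbrev ShortWord (k : ℕ) : Type := {w : FreeMonoid (Fin 3) // 0 < w.length ∧ w.length ≤ k}

noncomputable instance fintypeShortWord (k : ℕ) : Fintype (ShortWord k) :=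
  @Fintype.ofFinite _ (((List.finite_length_le (Fin 3) k).subset fun _ h => h.2).to_subtype)

/-- The exponent that all linear combinations of nonempty words of length at most `k` are given:
large enough for the relations that this imposes to be sparse. -/
noncomputable def nilExponent (k : ℕ) : ℕ :=
  (exists_succ_pow_mul_le_two_pow (Fintype.card (ShortWord k)) (2 ^ (k + 2)) k).choose

theorem nilExponent_spec (k : ℕ) : 0 < nilExponent k ∧ k ≤ nilExponent k ∧
    (nilExponent k + 1) ^ Fintype.card (ShortWord k) * 2 ^ (k + 2) ≤ 2 ^ nilExponent k :=
  (exists_succ_pow_mul_le_two_pow (Fintype.card (ShortWord k)) (2 ^ (k + 2)) k).choose_spec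

/-- The index set of the relations: a length bound `k` and a multiset of `nilExponent k` nonempty
words of length at most `k`. -/
abbrev NilIndex : Type := Σ k, Multiplicity (ShortWord k) (nilExponent k)

open Classical in
/-- The relations: the coefficients of the powers of generic polynomials of bounded degree without
constant term. -/
noncomputable def nilRelation (F : Type u) [Field F] (i : NilIndex) : WordAlgebra F :=
  powerCoefficient (fun j : ShortWord i.1 => monomialWord F j.1) i.2

/-- The degree of a relation, the total length of the words of its multiset. -/
noncomputable def nilDegree (i : NilIndex) : ℕ :=
  ∑ j, (i.2.1 j : ℕ) * j.1.length

theorem prod_ofFn_monomialWord_mem {F : Type u} [Field F] {N : ℕ}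
    (f : Fin N → FreeMonoid (Fin 3)) :
    (List.ofFn fun i => monomialWord F (f i)).prod ∈ homogeneousPart F (∑ i, (f i).length) := by
  induction N with
  | zero =>
    have h := monomialWord_mem_homogeneousPart (F := F) 1
    rw [map_one, FreeMonoid.length_one] at h
    simpa using h
  | succ N ih =>
    rw [List.ofFn_succ, List.prod_cons, Fin.sum_univ_succ]
    exact mul_mem_homogeneousPart (monomialWord_mem_homogeneousPart _) (ih _)

theorem nilRelation_mem_homogeneousPart (F : Type u) [Field F] (i : NilIndex) :
    nilRelation F i ∈ homogeneousPart F (nilDegree i) := by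
  classical
  refine Submodule.sum_mem _ fun f hf => ?_
  have h := prod_ofFn_monomialWord_mem (F := F) fun j => (f j).1
  rw [sum_comp_eq_multiplicity f fun j => j.1.length] at h
  rw [nilDegree, ← (Finset.mem_filter.1 hf).2]
  exact h

theorem nilExponent_le_nilDegree (i : NilIndex) : nilExponent i.1 ≤ nilDegree i := by
  calc nilExponent i.1 = ∑ j, (i.2.1 j : ℕ) := i.2.2.symm
    _ ≤ nilDegree i := Finset.sum_le_sum fun j _ => Nat.le_mul_of_pos_right _ j.2.1

theorem nilDegree_pos (i : NilIndex) : 0 < nilDegree i :=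
  (nilExponent_spec i.1).1.trans_le (nilExponent_le_nilDegree i)

theorem finite_nilDegree_le (n : ℕ) : {i | nilDegree i ≤ n}.Finite := by
  classical
  refine (Finset.finite_toSet ((Finset.range (n + 1)).sigma fun k =>
    (Finset.univ : Finset (Multiplicity (ShortWord k) (nilExponent k))))).subset fun i hi => ?_
  have h1 := (nilExponent_spec i.1).2.1
  have h2 := nilExponent_le_nilDegree i
  have h3 : nilDegree i ≤ n := hi
  simp only [Finset.coe_sigma, Set.mem_sigma_iff, Finset.mem_coe, Finset.mem_range,
    Finset.mem_univ, and_true]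
  omega

theorem sum_half_pow_nilDegree_le (s : Finset NilIndex) :
    ∑ i ∈ s, ((1 : ℚ) / 2) ^ nilDegree i ≤ 1 / 2 := by
  classical
  set K := s.sup Sigma.fst + 1 with hK
  have hsub : s ⊆ (Finset.range K).sigma fun k =>
      (Finset.univ : Finset (Multiplicity (ShortWord k) (nilExponent k))) := fun i hi => by
    have := Finset.le_sup (f := Sigma.fst) hi
    simp only [Finset.mem_sigma, Finset.mem_range, Finset.mem_univ, and_true]
    omega
  calc ∑ i ∈ s, ((1 : ℚ) / 2) ^ nilDegree i
      ≤ ∑ i ∈ s, ((1 : ℚ) / 2) ^ nilExponent i.1 := Finset.sum_le_sum fun i _ =>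
        pow_le_pow_of_le_one (by norm_num) (by norm_num) (nilExponent_le_nilDegree i)
    _ ≤ ∑ i ∈ (Finset.range K).sigma fun k =>
          (Finset.univ : Finset (Multiplicity (ShortWord k) (nilExponent k))),
          ((1 : ℚ) / 2) ^ nilExponent i.1 :=
        Finset.sum_le_sum_of_subset_of_nonneg hsub fun _ _ _ => by positivity
    _ = ∑ k ∈ Finset.range K, Fintype.card (Multiplicity (ShortWord k) (nilExponent k)) *
          ((1 : ℚ) / 2) ^ nilExponent k := by
        rw [Finset.sum_sigma]
        refine Finset.sum_congr rfl fun k _ => ?_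
        change ∑ _c : Multiplicity (ShortWord k) (nilExponent k), ((1 : ℚ) / 2) ^ nilExponent k = _
        rw [Finset.sum_const, nsmul_eq_mul, Finset.card_univ]
    _ ≤ ∑ k ∈ Finset.range K, ((1 : ℚ) / 2) ^ (k + 2) := by
        refine Finset.sum_le_sum fun k _ => ?_
        have h1 := card_multiplicity_le (ShortWord k) (nilExponent k)
        have h2 := (Nat.mul_le_mul_right (2 ^ (k + 2)) h1).trans (nilExponent_spec k).2.2
        have h3 : (Fintype.card (Multiplicity (ShortWord k) (nilExponent k)) : ℚ) * 2 ^ (k + 2) ≤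
          2 ^ nilExponent k := by exact_mod_cast h2
        rw [div_pow, one_pow, div_pow, one_pow, mul_one_div, div_le_div_iff₀ (by positivity)
          (by positivity), one_mul]
        exact h3
    _ = 1 / 2 - (1 / 2) ^ (K + 1) := by
        induction K with
        | zero => norm_num
        | succ K ih => rw [Finset.sum_range_succ, ih]; ring
    _ ≤ 1 / 2 := by
        have : (0 : ℚ) ≤ (1 / 2) ^ (K + 1) := by positivity
        linarith

/-- The polynomials without constant term. -/
noncomputable def augmentationPart (F : Type u) [Field F] : Submodule F (WordAlgebra F) :=
  Submodule.span F (monomialWord F '' {w | 0 < w.length})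

theorem mul_mem_augmentationPart {F : Type u} [Field F] {a b : WordAlgebra F}
    (ha : a ∈ augmentationPart F) (hb : b ∈ augmentationPart F) : a * b ∈ augmentationPart F := by
  have h := Submodule.mul_mem_mul ha hb
  unfold augmentationPart at h ⊢
  rw [Submodule.span_mul_span] at h
  refine Submodule.span_mono ?_ h
  rintro _ ⟨_, ⟨u, hu, rfl⟩, _, ⟨v, hv, rfl⟩, rfl⟩
  refine ⟨u * v, ?_, by simp⟩
  simp only [Set.mem_ofPred_eq, FreeMonoid.length_mul] at hu hv ⊢
  omega

theorem exists_mem_span_shortWord {F : Type u} [Field F] {a : WordAlgebra F}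
    (ha : a ∈ augmentationPart F) :
    ∃ k, a ∈ Submodule.span F (Set.range fun j : ShortWord k => monomialWord F j.1) := by
  have hmono : ∀ k l, k ≤ l → Submodule.span F (Set.range fun j : ShortWord k => monomialWord F j.1)
      ≤ Submodule.span F (Set.range fun j : ShortWord l => monomialWord F j.1) := by
    intro k l hkl
    refine Submodule.span_mono ?_
    rintro _ ⟨j, rfl⟩
    exact ⟨⟨j.1, j.2.1, j.2.2.trans hkl⟩, rfl⟩
  induction ha using Submodule.span_induction with
  | mem x hx =>
    obtain ⟨w, hw, rfl⟩ := hx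
    exact ⟨w.length, Submodule.subset_span ⟨⟨w, hw, le_rfl⟩, rfl⟩⟩
  | zero => exact ⟨0, Submodule.zero_mem _⟩
  | add x y _ _ hx hy =>
    obtain ⟨k, hk⟩ := hx
    obtain ⟨l, hl⟩ := hy
    exact ⟨max k l, Submodule.add_mem _ (hmono _ _ (le_max_left _ _) hk)
      (hmono _ _ (le_max_right _ _) hl)⟩
  | smul c x _ hx =>
    obtain ⟨k, hk⟩ := hx
    exact ⟨k, Submodule.smul_mem _ c hk⟩

theorem exists_pow_mem_span_nilRelation {F : Type u} [Field F] {a : WordAlgebra F}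
    (ha : a ∈ augmentationPart F) :
    ∃ N, a ^ N ∈ Submodule.span F (Set.range (nilRelation F)) := by
  classical
  obtain ⟨k, hk⟩ := exists_mem_span_shortWord ha
  obtain ⟨α, rfl⟩ := (Submodule.mem_span_range_iff_exists_fun F).1 hk
  refine ⟨nilExponent k, Submodule.span_mono ?_ (sum_smul_pow_mem_span _ α _)⟩
  rintro _ ⟨c, rfl⟩
  refine ⟨⟨k, c⟩, ?_⟩
  unfold nilRelation
  congr!

end PowerRelations

/-! ### A nil module with a functional of infinite Hankel rank -/

section NilModule

variable (F : Type u) [Field F]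

/-- The left ideal generated by the products of the relations with words; it is two-sided. -/
noncomputable def nilIdeal : Ideal (WordAlgebra F) :=
  Ideal.span {x | ∃ i v, x = nilRelation F i * monomialWord F v}

/-- The quotient of the free algebra by the relations, as a left module. -/
abbrev NilModule : Type u := WordAlgebra F ⧸ nilIdeal F

/-- The action of the free algebra on `NilModule F`. -/
noncomputable def nilAction : WordAlgebra F →ₐ[F] Module.End F (NilModule F) :=
  Algebra.lsmul F F (NilModule F)

variable {F}

theorem nilRelation_mul_mem_nilIdeal (i : NilIndex) (t : WordAlgebra F) :
    nilRelation F i * t ∈ nilIdeal F := by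
  have h : (⊤ : Submodule F (WordAlgebra F)) ≤
      ((nilIdeal F).restrictScalars F).comap (LinearMap.mulLeft F (nilRelation F i)) := by
    rw [← span_range_monomialWord]
    refine Submodule.span_le.2 ?_
    rintro _ ⟨v, rfl⟩
    rw [SetLike.mem_coe, Submodule.mem_comap, LinearMap.mulLeft_apply]
    exact Ideal.subset_span ⟨i, v, rfl⟩
  have := h (Submodule.mem_top (x := t))
  rwa [Submodule.mem_comap, LinearMap.mulLeft_apply] at this

theorem nilAction_mk (a t : WordAlgebra F) :
    nilAction F a (Submodule.Quotient.mk t) = Submodule.Quotient.mk (a * t) := rfl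

theorem mul_mem_nilIdeal_of_mem_span {b : WordAlgebra F}
    (hb : b ∈ Submodule.span F (Set.range (nilRelation F))) (t : WordAlgebra F) :
    b * t ∈ nilIdeal F := by
  have h : Submodule.span F (Set.range (nilRelation F)) ≤
      ((nilIdeal F).restrictScalars F).comap (LinearMap.mulRight F t) := by
    refine Submodule.span_le.2 ?_
    rintro _ ⟨i, rfl⟩
    rw [SetLike.mem_coe, Submodule.mem_comap, LinearMap.mulRight_apply]
    exact nilRelation_mul_mem_nilIdeal i t
  have := h hb
  rwa [Submodule.mem_comap, LinearMap.mulRight_apply] at this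

theorem isNilpotent_nilAction {a : WordAlgebra F} (ha : a ∈ augmentationPart F) :
    IsNilpotent (nilAction F a) := by
  obtain ⟨N, hN⟩ := exists_pow_mem_span_nilRelation ha
  refine ⟨N, ?_⟩
  rw [← map_pow]
  refine LinearMap.ext fun m => ?_
  obtain ⟨t, rfl⟩ := Submodule.Quotient.mk_surjective _ m
  rw [nilAction_mk, LinearMap.zero_apply]
  exact (Submodule.Quotient.mk_eq_zero _).2 (mul_mem_nilIdeal_of_mem_span hN t)

variable (F) in
/-- The exponents of the form `2 ^ i + 2 ^ j` that are powers of `2` are those with `i = j`, so a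
functional supported in the degrees `2 ^ (k + 1)` makes the halves of words of these degrees into
dual families. -/
theorem exists_functional_wordAlgebra :
    ∃ (f : WordAlgebra F →ₗ[F] F) (g h : ℕ → FreeMonoid (Fin 3)),
      (∀ x ∈ nilIdeal F, f x = 0) ∧
      ∀ i j, f (monomialWord F (g i * h j)) = if i = j then 1 else 0 := by
  classical
  have hw : ∀ n, ∃ w : FreeMonoid (Fin 3), w.length = n ∧
      monomialWord F w ∉ relationPart (nilRelation F) nilDegree n :=
    exists_monomialWord_notMem_relationPart (nilRelation_mem_homogeneousPart F) nilDegree_pos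
      finite_nilDegree_le sum_half_pow_nilDegree_le
  choose w hwlen hwmem using hw
  have hf : ∀ n, ∃ f : WordAlgebra F →ₗ[F] F, f (monomialWord F (w n)) = 1 ∧
      ∀ x ∈ relationPart (nilRelation F) nilDegree n, f x = 0 := by
    intro n
    obtain ⟨f, hf1, hf2⟩ := Submodule.exists_le_ker_of_notMem (hwmem n)
    refine ⟨(f (monomialWord F (w n)))⁻¹ • f, ?_, fun x hx => ?_⟩
    · rw [LinearMap.smul_apply, smul_eq_mul, inv_mul_cancel₀ hf1]
    · rw [LinearMap.smul_apply, LinearMap.mem_ker.1 (hf2 hx), smul_zero]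
  choose f hf1 hf2 using hf
  set φ : WordAlgebra F →ₗ[F] F := (MonoidAlgebra.basis (FreeMonoid (Fin 3)) F).constr F
    (fun v => if ∃ k, v.length = 2 ^ (k + 1) then f v.length (monomialWord F v) else 0) with hφ
  have hφw : ∀ v, φ (monomialWord F v) =
      if ∃ k, v.length = 2 ^ (k + 1) then f v.length (monomialWord F v) else 0 := by
    intro v
    have h := (MonoidAlgebra.basis (FreeMonoid (Fin 3)) F).constr_basis F
      (fun v => if ∃ k, v.length = 2 ^ (k + 1) then f v.length (monomialWord F v) else 0) v
    rw [MonoidAlgebra.basis_apply] at h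
    exact h
  have hφn : ∀ n, ∀ x ∈ homogeneousPart F n,
      φ x = (if ∃ k, n = 2 ^ (k + 1) then (1 : F) else 0) * f n x := by
    intro n x hx
    induction hx using Submodule.span_induction with
    | mem x hx =>
      obtain ⟨v, rfl, rfl⟩ := hx
      rw [hφw]
      split_ifs <;> simp
    | zero => simp
    | add x y _ _ hx hy => rw [map_add, map_add, hx, hy, mul_add]
    | smul c x _ hx => rw [map_smul, map_smul, hx, smul_eq_mul, smul_eq_mul, mul_left_comm]
  have hkill : ∀ x ∈ nilIdeal F, ∀ t, φ (t * x) = 0 := by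
    intro x hx
    induction hx using Submodule.span_induction with
    | mem x hx =>
      obtain ⟨i, v, rfl⟩ := hx
      have hle : (⊤ : Submodule F (WordAlgebra F)) ≤
          LinearMap.ker (φ ∘ₗ LinearMap.mulRight F (nilRelation F i * monomialWord F v)) := by
        rw [← span_range_monomialWord]
        refine Submodule.span_le.2 ?_
        rintro _ ⟨u, rfl⟩
        rw [SetLike.mem_coe, LinearMap.mem_ker, LinearMap.comp_apply, LinearMap.mulRight_apply,
          ← mul_assoc]
        have hmem : monomialWord F u * nilRelation F i * monomialWord F v ∈
            relationPart (nilRelation F) nilDegree (u.length + nilDegree i + v.length) :=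
          Submodule.subset_span ⟨u, i, v, rfl, rfl⟩
        rw [hφn _ _ (relationPart_le (nilRelation_mem_homogeneousPart F) _ hmem), hf2 _ _ hmem,
          mul_zero]
      intro t
      have := hle (Submodule.mem_top (x := t))
      rwa [LinearMap.mem_ker, LinearMap.comp_apply, LinearMap.mulRight_apply] at this
    | zero => simp
    | add x y _ _ hx hy => intro t; rw [mul_add, map_add, hx, hy, add_zero]
    | smul c x _ hx => intro t; rw [smul_eq_mul, ← mul_assoc, hx]
  refine ⟨φ, fun k => FreeMonoid.ofList ((w (2 ^ (k + 1))).toList.take (2 ^ k)),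
    fun k => FreeMonoid.ofList ((w (2 ^ (k + 1))).toList.drop (2 ^ k)), ?_, ?_⟩
  · intro x hx
    have := hkill x hx 1
    rwa [one_mul] at this
  · intro i j
    have hlen : ∀ k, (w (2 ^ (k + 1))).toList.length = 2 ^ (k + 1) := fun k => hwlen _
    split_ifs with hij
    · subst hij
      rw [← FreeMonoid.ofList_append, List.take_append_drop, FreeMonoid.ofList_toList, hφw,
        if_pos ⟨i, hwlen _⟩, hwlen, hf1]
    · rw [hφw, if_neg]
      rintro ⟨k, hk⟩
      rw [FreeMonoid.length_mul] at hk
      change (List.take _ _).length + (List.drop _ _).length = _ at hk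
      rw [List.length_take, List.length_drop, hlen, hlen, pow_succ, pow_succ, pow_succ,
        min_eq_left (by omega), Nat.mul_two, Nat.add_sub_cancel] at hk
      -- Binary expansions: `2 ^ i + 2 ^ j` with `i ≠ j` is not a power of `2`.
      have key : ∀ a b : ℕ, a < b → 2 ^ a + 2 ^ b ≠ 2 ^ k * 2 := by
        intro a b hab h
        have h1 : 2 ^ a < 2 ^ b := Nat.pow_lt_pow_right one_lt_two hab
        have h2 : 2 ^ b < 2 ^ (k + 1) := by
          rw [pow_succ]; have := Nat.two_pow_pos a; omega
        have h3 : 2 ^ (k + 1) < 2 ^ (b + 1) := by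
          rw [pow_succ, pow_succ]; omega
        have h4 := (Nat.pow_lt_pow_iff_right one_lt_two).1 h2
        have h5 := (Nat.pow_lt_pow_iff_right one_lt_two).1 h3
        omega
      rcases lt_or_gt_of_ne hij with h | h
      · exact key _ _ h hk
      · exact key _ _ h (by rw [add_comm]; exact hk)

variable (F) in
theorem exists_functional_nilModule :
    ∃ (φ : NilModule F →ₗ[F] F) (g h : ℕ → FreeMonoid (Fin 3)), ∀ i j,
      φ (nilAction F (monomialWord F (g i) * monomialWord F (h j)) (Submodule.Quotient.mk 1)) =
        if i = j then 1 else 0 := by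
  obtain ⟨f, g, h, hf, hgh⟩ := exists_functional_wordAlgebra F
  refine ⟨((nilIdeal F).restrictScalars F).liftQ f (fun x hx => hf x hx) ∘ₗ
    (Submodule.Quotient.restrictScalarsEquiv F (nilIdeal F)).symm.toLinearMap, g, h, fun i j => ?_⟩
  rw [← hgh, ← map_mul, nilAction_mk, mul_one]
  rfl

end NilModule

/-! ### A finitely generated nil algebra with an infinite dual family -/

section NilpotentElements

theorem NonUnitalSubalgebra.pow_succ_mem {F R : Type*} [CommRing F] [Ring R] [Algebra F R]
    (B : NonUnitalSubalgebra F R) {a : R} (ha : a ∈ B) (n : ℕ) : a ^ (n + 1) ∈ B := by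
  induction n with
  | zero => rwa [zero_add, pow_one]
  | succ n ih => rw [pow_succ]; exact B.mul_mem ih ha

/-- A non-unital algebra of nilpotent elements is Jacobson radical, by the geometric series. -/
theorem isJacobsonRadicalRing_of_isNilpotent {F R : Type*} [CommRing F] [Ring R] [Algebra F R]
    (B : NonUnitalSubalgebra F R) (hB : ∀ a ∈ B, IsNilpotent a) : IsJacobsonRadicalRing B := by
  rintro ⟨a, ha⟩
  obtain ⟨n, hn⟩ := hB a ha
  have hy : ∑ k ∈ Finset.range n, (-a) ^ (k + 1) ∈ B :=
    sum_mem fun k _ => B.pow_succ_mem (neg_mem ha) k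
  have h1 : (1 + a) * (1 + ∑ k ∈ Finset.range n, (-a) ^ (k + 1)) = 1 := by
    have h := mul_neg_geom_sum (-a) (n + 1)
    rw [Finset.sum_range_succ', pow_zero, add_comm _ (1 : R), sub_neg_eq_add, pow_succ, neg_pow a n,
      hn, mul_zero, zero_mul, sub_zero] at h
    exact h
  have h2 : (1 + ∑ k ∈ Finset.range n, (-a) ^ (k + 1)) * (1 + a) = 1 := by
    have h := geom_sum_mul_neg (-a) (n + 1)
    rw [Finset.sum_range_succ', pow_zero, add_comm _ (1 : R), sub_neg_eq_add, pow_succ, neg_pow a n,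
      hn, mul_zero, zero_mul, sub_zero] at h
    exact h
  refine isQuasiregular_iff.2 ⟨⟨_, hy⟩, Subtype.ext ?_, Subtype.ext ?_⟩
  · change ∑ k ∈ Finset.range n, (-a) ^ (k + 1) + a + a * ∑ k ∈ Finset.range n, (-a) ^ (k + 1) = 0
    rw [← sub_eq_zero] at h1
    rw [← h1]
    noncomm_ring
  · change a + ∑ k ∈ Finset.range n, (-a) ^ (k + 1) + (∑ k ∈ Finset.range n, (-a) ^ (k + 1)) * a = 0
    rw [← sub_eq_zero] at h2
    rw [← h2]
    noncomm_ring

theorem isNilpotent_matrix_of_middle {E : Type*} [Ring E] {a b g d : E} (hg : IsNilpotent g) :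
    IsNilpotent !![0, a, b; 0, g, d; 0, 0, 0] := by
  obtain ⟨n, hn⟩ := hg
  have h : ∀ n, !![0, a, b; 0, g, d; 0, 0, 0] ^ (n + 2) =
      !![0, a * g ^ (n + 1), a * g ^ n * d; 0, g ^ (n + 2), g ^ (n + 1) * d; 0, 0, 0] := by
    intro n
    induction n with
    | zero => rw [pow_two, Matrix.mul_fin_three]; simp [pow_two]
    | succ n ih =>
      rw [pow_succ, ih, Matrix.mul_fin_three]
      simp [mul_assoc, pow_succ]
  refine ⟨n + 2, ?_⟩
  rw [h, pow_add, pow_add, hn]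
  ext i j
  fin_cases i <;> fin_cases j <;> simp

end NilpotentElements

section TriangularAlgebra

variable {F : Type u} [Field F] {E : Type u} [Ring E] [Algebra F E]

/-- The generators of `triangularAlgebra`. -/
def triangularGenerators (x : Fin 3 → E) (c : E) : Set (Matrix (Fin 3) (Fin 3) E) :=
  Set.range (fun i => Matrix.single 1 1 (x i)) ∪ {Matrix.single 0 1 c, Matrix.single 1 2 c}

variable (F) in
/-- The algebra of matrices generated by copies of the `x i` in the central position, one copy of
`c` to the left of these and one copy of `c` to the right. -/
def triangularAlgebra (x : Fin 3 → E) (c : E) : NonUnitalSubalgebra F (Matrix (Fin 3) (Fin 3) E) :=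
  NonUnitalAlgebra.adjoin F (triangularGenerators x c)

theorem isFinitelyGeneratedAlgebra_adjoin {R : Type*} [Ring R] [Algebra F R] {s : Set R}
    (hs : s.Finite) : IsFinitelyGeneratedAlgebra F (NonUnitalAlgebra.adjoin F s) := by
  have hfin : (((↑) : NonUnitalAlgebra.adjoin F s → R) ⁻¹' s).Finite :=
    hs.preimage Subtype.val_injective.injOn
  refine ⟨hfin.toFinset, ?_⟩
  rw [hfin.coe_toFinset]
  refine eq_top_iff.2 fun a _ => ?_
  have himg : NonUnitalSubalgebra.map (NonUnitalSubalgebraClass.subtype (NonUnitalAlgebra.adjoin F s))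
      (NonUnitalAlgebra.adjoin F (((↑) : NonUnitalAlgebra.adjoin F s → R) ⁻¹' s)) =
      NonUnitalAlgebra.adjoin F s := by
    rw [NonUnitalAlgHom.map_adjoin]
    congr 1
    change Subtype.val '' (Subtype.val ⁻¹' s) = s
    refine Set.image_preimage_eq_of_subset ?_
    rw [Subtype.range_coe]
    exact NonUnitalAlgebra.subset_adjoin F
  have ha : (a : R) ∈ NonUnitalSubalgebra.map
      (NonUnitalSubalgebraClass.subtype (NonUnitalAlgebra.adjoin F s))
      (NonUnitalAlgebra.adjoin F (((↑) : NonUnitalAlgebra.adjoin F s → R) ⁻¹' s)) := by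
    rw [himg]; exact a.2
  obtain ⟨b, hb, hba⟩ := ha
  rwa [← Subtype.val_injective hba]

theorem exists_eq_of_mem_triangularAlgebra (S : NonUnitalSubalgebra F E) {x : Fin 3 → E}
    (hx : ∀ i, x i ∈ S) {c : E} {M : Matrix (Fin 3) (Fin 3) E} (hM : M ∈ triangularAlgebra F x c) :
    ∃ a b d, ∃ g ∈ S, M = !![0, a, b; 0, g, d; 0, 0, 0] := by
  unfold triangularAlgebra at hM
  induction hM using NonUnitalAlgebra.adjoin_induction with
  | mem M hM =>
    rcases hM with ⟨i, rfl⟩ | rfl | rfl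
    · refine ⟨0, 0, 0, x i, hx i, ?_⟩
      ext i j
      fin_cases i <;> fin_cases j <;> simp [Matrix.single]
    · refine ⟨c, 0, 0, 0, S.zero_mem, ?_⟩
      ext i j
      fin_cases i <;> fin_cases j <;> simp [Matrix.single]
    · refine ⟨0, 0, c, 0, S.zero_mem, ?_⟩
      ext i j
      fin_cases i <;> fin_cases j <;> simp [Matrix.single]
  | add M M' _ _ h h' =>
    obtain ⟨a, b, d, g, hg, rfl⟩ := h
    obtain ⟨a', b', d', g', hg', rfl⟩ := h'
    refine ⟨a + a', b + b', d + d', g + g', S.add_mem hg hg', ?_⟩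
    ext i j
    fin_cases i <;> fin_cases j <;> simp
  | zero =>
    refine ⟨0, 0, 0, 0, S.zero_mem, ?_⟩
    ext i j
    fin_cases i <;> fin_cases j <;> simp
  | mul M M' _ _ h h' =>
    obtain ⟨a, b, d, g, hg, rfl⟩ := h
    obtain ⟨a', b', d', g', hg', rfl⟩ := h'
    refine ⟨a * g', a * d', g * d', g * g', S.mul_mem hg hg', ?_⟩
    rw [Matrix.mul_fin_three]
    simp
  | smul r M _ h =>
    obtain ⟨a, b, d, g, hg, rfl⟩ := h
    refine ⟨r • a, r • b, r • d, r • g, SMulMemClass.smul_mem r hg, ?_⟩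
    ext i j
    fin_cases i <;> fin_cases j <;> simp

theorem isNilpotent_of_mem_triangularAlgebra (S : NonUnitalSubalgebra F E)
    (hS : ∀ g ∈ S, IsNilpotent g) {x : Fin 3 → E} (hx : ∀ i, x i ∈ S) {c : E}
    {M : Matrix (Fin 3) (Fin 3) E} (hM : M ∈ triangularAlgebra F x c) : IsNilpotent M := by
  obtain ⟨a, b, d, g, hg, rfl⟩ := exists_eq_of_mem_triangularAlgebra S hx hM
  exact isNilpotent_matrix_of_middle (hS g hg)

variable (x : Fin 3 → E) (c : E)

theorem single_zero_one_mem_triangularAlgebra (w : FreeMonoid (Fin 3)) :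
    Matrix.single 0 1 (c * FreeMonoid.lift x w) ∈ triangularAlgebra F x c := by
  have h : ∀ y : E, Matrix.single 0 1 y ∈ triangularAlgebra F x c →
      Matrix.single 0 1 (y * FreeMonoid.lift x w) ∈ triangularAlgebra F x c := by
    induction w using FreeMonoid.inductionOn' with
    | one => simp
    | of_mul i w ih =>
      intro y hy
      rw [map_mul, ← mul_assoc]
      refine ih _ ?_
      rw [FreeMonoid.lift_eval_of, ← Matrix.single_mul_single_same (j := (1 : Fin 3))]
      exact mul_mem hy (NonUnitalAlgebra.subset_adjoin F (Or.inl ⟨i, rfl⟩))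
  exact h c (NonUnitalAlgebra.subset_adjoin F (Or.inr (Or.inl rfl)))

theorem single_one_two_mem_triangularAlgebra (w : FreeMonoid (Fin 3)) :
    Matrix.single 1 2 (FreeMonoid.lift x w * c) ∈ triangularAlgebra F x c := by
  induction w using FreeMonoid.inductionOn' with
  | one =>
    rw [map_one, one_mul]
    exact NonUnitalAlgebra.subset_adjoin F (Or.inr (Or.inr rfl))
  | of_mul i w ih =>
    rw [map_mul, mul_assoc, FreeMonoid.lift_eval_of, ← Matrix.single_mul_single_same (j := (1 : Fin 3))]
    exact mul_mem (NonUnitalAlgebra.subset_adjoin F (Or.inl ⟨i, rfl⟩)) ih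

end TriangularAlgebra

section DualFamilies

variable (F : Type u) [Field F]

/-- The image of the polynomials without constant term in the endomorphisms of `NilModule F`. -/
noncomputable def nilImage : NonUnitalSubalgebra F (Module.End F (NilModule F)) where
  __ := (augmentationPart F).map (nilAction F).toLinearMap
  mul_mem' := by
    rintro _ _ ⟨a, ha, rfl⟩ ⟨b, hb, rfl⟩
    exact ⟨a * b, mul_mem_augmentationPart ha hb, map_mul (nilAction F) a b⟩

theorem lift_nilAction_letter (w : FreeMonoid (Fin 3)) :
    FreeMonoid.lift (fun i => nilAction F (monomialWord F (FreeMonoid.of i))) w =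
      nilAction F (monomialWord F w) := by
  have h : FreeMonoid.lift (fun i => nilAction F (monomialWord F (FreeMonoid.of i))) =
      ((nilAction F : WordAlgebra F →* Module.End F (NilModule F)).comp (monomialWord F)) :=
    FreeMonoid.hom_eq fun i => by simp
  rw [h]
  rfl

/-- The algebra is `triangularAlgebra F x c` for the actions `x i` of the letters on `NilModule F`
and the rank one operator `c` given by the functional of `exists_functional_nilModule`. -/
theorem exists_radical_algebra_with_dual_families :
    ∃ (A : Type u) (_ : NonUnitalRing A) (_ : Module F A) (_ : IsScalarTower F A A)
      (_ : SMulCommClass F A A),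
      IsFinitelyGeneratedAlgebra F A ∧ IsJacobsonRadicalRing A ∧
        ∃ (p q : ℕ → A) (z : A), z ≠ 0 ∧ ∀ i j, p i * q j = if i = j then z else 0 := by
  obtain ⟨φ, g, h, hgh⟩ := exists_functional_nilModule F
  set v : NilModule F := Submodule.Quotient.mk 1 with hv
  set x : Fin 3 → Module.End F (NilModule F) :=
    fun i => nilAction F (monomialWord F (FreeMonoid.of i)) with hx
  set c : Module.End F (NilModule F) := φ.smulRight v with hc
  -- `c` has rank one, so that `c * T * c` is a multiple of `c`.
  have hcc : ∀ T : Module.End F (NilModule F), c * T * c = φ (T v) • c := by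
    intro T
    refine LinearMap.ext fun m => ?_
    rw [Module.End.mul_apply, Module.End.mul_apply, LinearMap.smul_apply, hc,
      LinearMap.smulRight_apply, LinearMap.smulRight_apply, map_smul, map_smul, smul_assoc,
      smul_comm]
  have hc0 : c ≠ 0 := by
    intro h0
    have h1 := hgh 0 0
    rw [if_pos rfl] at h1
    have h2 := LinearMap.congr_fun h0
      (nilAction F (monomialWord F (g 0) * monomialWord F (h 0)) v)
    rw [hc, LinearMap.smulRight_apply, h1, one_smul, LinearMap.zero_apply] at h2
    rw [h2, map_zero, map_zero] at h1
    exact zero_ne_one h1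
  have hxmem : ∀ i, x i ∈ nilImage F := fun i =>
    ⟨monomialWord F (FreeMonoid.of i), Submodule.subset_span ⟨_, by simp, rfl⟩, rfl⟩
  have hnil : ∀ T ∈ nilImage F, IsNilpotent T := by
    rintro _ ⟨a, ha, rfl⟩
    exact isNilpotent_nilAction ha
  have hprod : ∀ i j, (Matrix.single 0 1 (c * FreeMonoid.lift x (g i)) *
      Matrix.single 1 2 (FreeMonoid.lift x (h j) * c) :
        Matrix (Fin 3) (Fin 3) (Module.End F (NilModule F))) =
      if i = j then Matrix.single 0 2 c else 0 := by
    intro i j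
    rw [Matrix.single_mul_single_same, mul_assoc, ← mul_assoc (FreeMonoid.lift x (g i)),
      ← mul_assoc, lift_nilAction_letter, lift_nilAction_letter, ← map_mul, hcc, hgh]
    split_ifs <;> simp
  have hz : Matrix.single 0 2 c ∈ triangularAlgebra F x c := by
    have h00 := mul_mem (single_zero_one_mem_triangularAlgebra (F := F) x c (g 0))
      (single_one_two_mem_triangularAlgebra (F := F) x c (h 0))
    rwa [hprod, if_pos rfl] at h00
  refine ⟨triangularAlgebra F x c, inferInstance, inferInstance, inferInstance, inferInstance,
    isFinitelyGeneratedAlgebra_adjoin ((Set.finite_range _).union (Set.toFinite _)),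
    isJacobsonRadicalRing_of_isNilpotent _ fun M hM =>
      isNilpotent_of_mem_triangularAlgebra (nilImage F) hnil hxmem hM,
    fun i => ⟨_, single_zero_one_mem_triangularAlgebra x c (g i)⟩,
    fun j => ⟨_, single_one_two_mem_triangularAlgebra x c (h j)⟩,
    ⟨_, hz⟩, ?_, fun i j => Subtype.ext ?_⟩
  · intro h0
    refine hc0 ?_
    have h1 := congrFun (congrFun (congrArg Subtype.val h0) 0) 2
    simpa using h1
  · rw [NonUnitalSubalgebra.coe_mul, hprod]
    split_ifs <;> rfl

end DualFamilies

/-! ### Dual families and asymptotic rank -/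

section RankInequality

/-- If the block matrix `(P i * Q j)`, which factors through `F ^ N`, is close to the block diagonal
matrix with `m` blocks `Z`, then `Z` has rank at most about `N / m`. -/
theorem card_mul_rank_le {F : Type u} [Field F] {N m : ℕ}
    (P Q : Fin m → Matrix (Fin N) (Fin N) F) (Z : Matrix (Fin N) (Fin N) F) :
    m * Z.rank ≤ N + ∑ ij : Fin m × Fin m,
      (P ij.1 * Q ij.2 - if ij.1 = ij.2 then Z else 0).rank := by
  classical
  set V := Fin N → F
  set L : V →ₗ[F] (Fin m → V) := LinearMap.pi fun i => (P i).mulVecLin with hL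
  set W : (Fin m → LinearMap.range Z.mulVecLin) →ₗ[F] (Fin m → V) :=
    LinearMap.pi fun i => (Submodule.subtype _) ∘ₗ LinearMap.proj i with hW
  set R : Fin m × Fin m → Submodule F (Fin m → V) := fun ij =>
    (LinearMap.range (P ij.1 * Q ij.2 - if ij.1 = ij.2 then Z else 0).mulVecLin).map
      (LinearMap.single F (fun _ : Fin m => V) ij.1) with hR
  have hWinj : Function.Injective W := by
    intro a b hab
    funext i
    exact Subtype.ext (congrFun hab i)
  have hWrank : Module.finrank F (LinearMap.range W) = m * Z.rank := by
    rw [LinearMap.finrank_range_of_inj hWinj, Module.finrank_pi_fintype]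
    simp [Matrix.rank]
  have hle : LinearMap.range W ≤ LinearMap.range L ⊔ Finset.univ.sup R := by
    rintro _ ⟨a, rfl⟩
    choose b hb using fun i => (a i).2
    have key : W a = L (∑ j, (Q j).mulVecLin (b j)) -
        ∑ ij : Fin m × Fin m, LinearMap.single F (fun _ : Fin m => V) ij.1
          ((P ij.1 * Q ij.2 - if ij.1 = ij.2 then Z else 0).mulVecLin (b ij.2)) := by
      funext i
      have h1 : W a i = Z.mulVecLin (b i) := (hb i).symm
      have h2 : L (∑ j, (Q j).mulVecLin (b j)) i = ∑ j, (P i * Q j).mulVecLin (b j) := by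
        rw [map_sum, Finset.sum_apply]
        exact Finset.sum_congr rfl fun j _ => by rw [Matrix.mulVecLin_mul]; rfl
      have h3 : (∑ ij : Fin m × Fin m, LinearMap.single F (fun _ : Fin m => V) ij.1
          ((P ij.1 * Q ij.2 - if ij.1 = ij.2 then Z else 0).mulVecLin (b ij.2))) i =
          ∑ j, (P i * Q j).mulVecLin (b j) - Z.mulVecLin (b i) := by
        rw [Finset.sum_apply, Fintype.sum_prod_type, Finset.sum_eq_single i]
        · simp only [LinearMap.single_apply, Pi.single_eq_same, Matrix.mulVecLin_apply,
            Matrix.sub_mulVec, Finset.sum_sub_distrib]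
          congr 1
          rw [Finset.sum_eq_single i]
          · simp
          · intro j _ hj
            rw [if_neg (Ne.symm hj), Matrix.zero_mulVec]
          · simp
        · intro j _ hj
          refine Finset.sum_eq_zero fun k _ => ?_
          simp [Pi.single_eq_of_ne (Ne.symm hj)]
        · simp
      rw [Pi.sub_apply, h1, h2, h3, sub_sub_cancel]
    rw [key]
    refine Submodule.sub_mem _ (Submodule.mem_sup_left ⟨_, rfl⟩) (Submodule.mem_sup_right ?_)
    exact Submodule.sum_mem _ fun ij _ =>
      (Finset.le_sup (f := R) (Finset.mem_univ ij)) ⟨_, ⟨_, rfl⟩, rfl⟩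
  rw [← hWrank]
  refine (Submodule.finrank_mono hle).trans
    ((Submodule.finrank_add_le_finrank_add_finrank _ _).trans (add_le_add ?_ ?_))
  · exact (LinearMap.finrank_range_le L).trans (by simp [V])
  · refine (Submodule.finrank_finset_sup_le _ _ fun _ _ => inferInstance).2.trans (Finset.sum_le_sum fun ij _ => ?_)
    exact Submodule.finrank_map_le _ _

end RankInequality

section NotLinearSofic

theorem IsLinearSofic.of_injective {F : Type*} [Field F] {A B : Type*} [NonUnitalRing A]
    [Module F A] [NonUnitalRing B] [Module F B] (f : A →ₙₐ[F] B) (hf : Function.Injective f)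
    (hB : IsLinearSofic F B) : IsLinearSofic F A := by
  obtain ⟨U, n, hU, hn, Φ, hΦ⟩ := hB
  exact ⟨U, n, hU, hn, Φ.comp f, hΦ.comp hf⟩

/-- In a linear sofic algebra there are no infinite dual families: the rank of `z` would be
at most `1 / m` for all `m`. -/
theorem not_isLinearSofic_of_dual_families {F : Type u} [Field F] {A : Type*} [NonUnitalRing A]
    [Module F A] {p q : ℕ → A} {z : A} (hz : z ≠ 0)
    (hpq : ∀ i j, p i * q j = if i = j then z else 0) : ¬ IsLinearSofic F A := by
  rintro ⟨U, n, -, -, Φ, hΦ⟩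
  choose P hP using fun i => Ideal.Quotient.mk_surjective (I := rankKernel F U n) (Φ (p i))
  choose Q hQ using fun i => Ideal.Quotient.mk_surjective (I := rankKernel F U n) (Φ (q i))
  obtain ⟨Z, hZ⟩ := Ideal.Quotient.mk_surjective (I := rankKernel F U n) (Φ z)
  have hZ0 : asymptoticRank U n Z ≠ 0 := by
    intro h0
    refine hz (hΦ ?_)
    rw [map_zero, ← hZ]
    exact Ideal.Quotient.eq_zero_iff_mem.2 h0
  have herr : ∀ i j, asymptoticRank U n (P i * Q j - if i = j then Z else 0) = 0 := by
    intro i j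
    have h : Ideal.Quotient.mk (rankKernel F U n) (P i * Q j - if i = j then Z else 0) = 0 := by
      rw [map_sub, map_mul, hP, hQ, ← map_mul, hpq]
      split_ifs
      · rw [hZ, sub_self]
      · rw [map_zero, map_zero, sub_self]
    exact Ideal.Quotient.eq_zero_iff_mem.1 h
  have hbound : ∀ m : ℕ, m * asymptoticRank U n Z ≤ 1 := by
    intro m
    have h1 := (tendsto_asymptoticRank U n Z).const_mul (m : ℝ)
    have h2 : Tendsto (fun k => 1 + ∑ ij : Fin m × Fin m,
        ((((P ij.1 * Q ij.2 - if ij.1 = ij.2 then Z else 0) : MatrixProduct F n) k).rank : ℝ) /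
          n k) (U : Filter ℕ) (𝓝 (1 + ∑ _ij : Fin m × Fin m, 0)) := by
      refine tendsto_const_nhds.add (tendsto_finsetSum _ fun ij _ => ?_)
      have h := tendsto_asymptoticRank U n (P ij.1 * Q ij.2 - if ij.1 = ij.2 then Z else 0)
      have h' := herr ij.1 ij.2
      simp only [Fin.val_inj] at h'
      rwa [h'] at h
    rw [Finset.sum_const_zero, add_zero] at h2
    refine le_of_tendsto_of_tendsto' h1 h2 fun k => ?_
    have h3 := card_mul_rank_le (fun i : Fin m => P i k) (fun j : Fin m => Q j k) (Z k)
    have h4 : ((m : ℝ) * (Z k).rank) ≤ n k + ∑ ij : Fin m × Fin m,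
        ((((P ij.1 * Q ij.2 - if ij.1 = ij.2 then Z else 0) : MatrixProduct F n) k).rank : ℝ) := by
      have h5 := (Nat.cast_le (α := ℝ)).2 h3
      push_cast at h5
      refine h5.trans (le_of_eq ?_)
      congr 1
      refine Finset.sum_congr rfl fun ij _ => ?_
      congr 2
      split_ifs <;> rfl
    rw [← Finset.sum_div, ← mul_div_assoc]
    refine (div_le_div_of_nonneg_right h4 (Nat.cast_nonneg _)).trans ?_
    rw [add_div]
    gcongr
    exact div_self_le_one _
  have hnonneg : 0 ≤ asymptoticRank U n Z :=
    ge_of_tendsto' (tendsto_asymptoticRank U n Z) fun k => by positivity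
  obtain ⟨m, hm⟩ := exists_nat_gt (1 / asymptoticRank U n Z)
  have hpos := lt_of_le_of_ne hnonneg (Ne.symm hZ0)
  rw [div_lt_iff₀ hpos] at hm
  exact absurd (hbound m) (not_le.2 hm)

end NotLinearSofic

/-! ### Stable finiteness of the unital hull -/

section StablyFinite

variable {F : Type*} [Field F] {A : Type*} [NonUnitalRing A] [Module F A] [IsScalarTower F A A]
  [SMulCommClass F A A]

theorem mem_jacobson_bot_unitization (hA : IsJacobsonRadicalRing A) {x : Unitization F A}
    (hx : x.fst = 0) : x ∈ (⊥ : Ideal (Unitization F A)).jacobson := by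
  refine Ideal.mem_jacobson_iff.2 fun y => ?_
  have h : y * x = ((y * x).snd : A) := by
    refine Unitization.ext ?_ ?_
    · simp [hx]
    · simp
  obtain ⟨u, hu⟩ := (isQuasiregular_iff_isUnit' F).1 (hA (y * x).snd)
  rw [← h] at hu
  refine ⟨(u⁻¹ : (Unitization F A)ˣ), ?_⟩
  have h1 : ((u⁻¹ : (Unitization F A)ˣ) : Unitization F A) * (1 + y * x) = 1 := by
    rw [← hu, Units.inv_mul]
  rw [Ideal.mem_bot, sub_eq_zero, ← h1, mul_add, mul_one, mul_assoc, add_comm]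

/-- Modulo its Jacobson radical, a matrix ring over the unital hull is a matrix ring over `F`, and
the radical contains no nonzero idempotent `1 - Y * X`. -/
theorem isStablyFiniteRing_unitization (hA : IsJacobsonRadicalRing A) :
    IsStablyFiniteRing (Unitization F A) := by
  refine ⟨fun n => ⟨fun {X Y} hXY => ?_⟩⟩
  let π : Matrix (Fin n) (Fin n) (Unitization F A) →+* Matrix (Fin n) (Fin n) F :=
    (Unitization.fstHom F A).toRingHom.mapMatrix
  have hπ : π (Y * X) = 1 := by
    have h : π X * π Y = 1 := by rw [← map_mul, hXY, map_one]
    rw [map_mul, mul_eq_one_comm.1 h]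
  have hmem : 1 - Y * X ∈ (⊥ : Ideal (Matrix (Fin n) (Fin n) (Unitization F A))).jacobson := by
    have h : 1 - Y * X ∈ ((⊥ : Ideal (Unitization F A)).jacobson).matrix (Fin n) := by
      intro i j
      refine mem_jacobson_bot_unitization hA ?_
      have h0 : π (1 - Y * X) = 0 := by rw [map_sub, map_one, hπ, sub_self]
      exact congrFun (congrFun h0 i) j
    have := Ideal.matrix_jacobson_le _ h
    rwa [Ideal.matrix_bot] at this
  have hidem : (Y * X) * (Y * X) = Y * X := by
    rw [mul_assoc, ← mul_assoc X, hXY, one_mul]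
  obtain ⟨z, hz⟩ := Ideal.mem_jacobson_iff.1 hmem (-1)
  rw [Ideal.mem_bot] at hz
  have hz' : z * (Y * X) = 1 := by
    rw [← sub_eq_zero, ← hz]
    noncomm_ring
  calc Y * X = z * (Y * X) * (Y * X) := by rw [hz', one_mul]
    _ = 1 := by rw [mul_assoc, hidem, hz']

end StablyFinite

theorem theorem1p3 (F : Type u) [Field F] :
    ∃ (A : Type u) (_ : NonUnitalRing A) (_ : Module F A) (_ : IsScalarTower F A A)
      (_ : SMulCommClass F A A),
      IsFinitelyGeneratedAlgebra F A ∧ IsJacobsonRadicalRing A ∧ ¬ IsLinearSofic F A ∧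
        ¬ IsLinearSofic F (Unitization F A) ∧ IsStablyFiniteRing (Unitization F A) := by
  obtain ⟨A, _, _, _, _, hfg, hA, p, q, z, hz, hpq⟩ := exists_radical_algebra_with_dual_families F
  have hns : ¬ IsLinearSofic F A := not_isLinearSofic_of_dual_families hz hpq
  exact ⟨A, inferInstance, inferInstance, inferInstance, inferInstance, hfg, hA, hns,
    fun h => hns (h.of_injective (Unitization.inrNonUnitalAlgHom F A) Unitization.inr_injective),
    isStablyFiniteRing_unitization hA⟩
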